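/- Let $d\ge 1$ and let $e^{-it\Delta}$, $t\in\mathbb{R}$, be the unitary group on $L^2(\mathbb{R}^d)$ generated by the self-adjoint operator $-\Delta$ (so that $u(t)=e^{it\Delta}f_0$ solves the free Schrödinger equation $\partial_t u=i\Delta u$, $u(0)=f_0$). For $T>0$ and $f_0\in L^2(\mathbb{R}^d)$ put $$P^Tf_0:=\frac{1}{2T}\int_{-T}^{T}e^{-it\Delta}f_0\,\mathrm{d}t .$$ For $s\in\mathbb{R}$ let $\|f\|_{L^{2,s}}^2:=\int_{\mathbb{R}^d}|f(x)|^2(1+|x|^2)^s\,\mathrm{d}x$, and let $L^{2,s}(\mathbb{R}^d)$ be the set of all $f\in L^2(\mathbb{R}^d)$ for which this is finite. For a measurable set $\Omega\subset\mathbb{R}^d$ the norm of $L^q_TL^2_x([0,\infty)\times\Omega)$ is the $L^q$ norm over $T\in[0,\infty)$ of $T\mapsto\|P^Tf_0\|_{L^2(\Omega)}$. (1) Let $s>\frac12$. For every real $\ell<\frac12$ there is a constant $C=C(d,s,\ell)$ such that for all $f_0\in L^{2,s}(\mathbb{R}^d)$ and all $T>1$ $$\|P^Tf_0\|_{L^2(\mathbb{R}^d)}\le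 C\,T^{-\ell/2}\,\|f_0\|_{L^{2,s}(\mathbb{R}^d)} .$$ (2) Let $s>\frac12$. For every $q\in(4,\infty]$ there is a constant $C=C(d,s,q)$ such that for all $f_0\in L^{2,s}(\mathbb{R}^d)$ $$\|P^Tf_0\|_{L^q_TL^2_x([0,\infty)\times\mathbb{R}^d)}\le C\,\|f_0\|_{L^{2,s}(\mathbb{R}^d)} .$$ (3) Let $\Omega\subset\mathbb{R}^d$ be a bounded open set. For every $q\in(4,\infty]$ there is a constant $C=C(q,\Omega)$ such that for all $f_0\in L^2(\Omega)$, extended by zero to $\mathbb{R}^d$, $$\|P^Tf_0\|_{L^q_TL^2_x([0,\infty)\times\Omega)}\le C\,\|f_0\|_{L^2(\Omega)} .$$ -/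

import Mathlib

open MeasureTheory FourierTransform
open scoped ENNReal NNReal

noncomputable section

/-- `L²(ℝᵈ)`: complex-valued square-integrable functions for Lebesgue measure on Euclidean space. -/
abbrev L2Space (d : ℕ) : Type :=
  Lp (α := EuclideanSpace ℝ (Fin d)) ℂ 2 volume

/-- The symbol of `e^{-itΔ}`. With the normalization `𝓕 f ξ = ∫ e^{-2πi⟨x,ξ⟩} f x dx` used by
Mathlib, `-Δ` is multiplication by `(2π‖ξ‖)²` on the Fourier side. -/
def schrodingerSymbol {d : ℕ} (t : ℝ) (ξ : EuclideanSpace ℝ (Fin d)) : ℂ :=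
  Complex.exp (Complex.I * ((t * (2 * Real.pi * ‖ξ‖) ^ 2 : ℝ) : ℂ))

lemma norm_schrodingerSymbol {d : ℕ} (t : ℝ) (ξ : EuclideanSpace ℝ (Fin d)) :
    ‖schrodingerSymbol t ξ‖ = 1 := by
  rw [schrodingerSymbol, mul_comm, Complex.norm_exp_ofReal_mul_I]

lemma continuous_schrodingerSymbol {d : ℕ} (t : ℝ) :
    Continuous (schrodingerSymbol (d := d) t) := by
  unfold schrodingerSymbol
  fun_prop

lemma memLp_schrodingerSymbol_mul {d : ℕ} (t : ℝ) (g : L2Space d) :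
    MemLp (fun ξ => schrodingerSymbol t ξ * g ξ) 2 volume := by
  refine (Lp.memLp g).of_le
    ((continuous_schrodingerSymbol t).aestronglyMeasurable.mul (Lp.aestronglyMeasurable g)) ?_
  filter_upwards with ξ
  rw [norm_mul, norm_schrodingerSymbol, one_mul]

/-- The unitary group `U_t = e^{itH} = e^{-itΔ}` on `L²(ℝᵈ)` generated by the self-adjoint operator
`H = -Δ`, i.e. the Fourier multiplier with symbol `e^{it|2πξ|²}`. -/
def schrodingerGroup {d : ℕ} (t : ℝ) (f : L2Space d) : L2Space d :=
  𝓕⁻ ((memLp_schrodingerSymbol_mul t (𝓕 f)).toLp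
    (fun ξ => schrodingerSymbol t ξ * (𝓕 f : L2Space d) ξ) : L2Space d)

/-- The ergodic average `P^T f = (2T)⁻¹ ∫_{-T}^{T} e^{-itΔ} f dt`, a Bochner integral in `L²(ℝᵈ)`.
As the window is symmetric, this is also the average over `[-T, T]` of the solution `e^{itΔ} f` of
`∂ₜ u = i Δ u`, `u(0) = f`. -/
def timeAverage {d : ℕ} (T : ℝ) (f : L2Space d) : L2Space d :=
  (2 * T)⁻¹ • ∫ t in (-T)..T, schrodingerGroup t f

lemma norm_schrodingerGroup {d : ℕ} (t : ℝ) (f : L2Space d) : ‖schrodingerGroup t f‖ = ‖f‖ := by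
  have h1 : ‖schrodingerGroup t f‖ = ‖((memLp_schrodingerSymbol_mul t (𝓕 f)).toLp
      (fun ξ => schrodingerSymbol t ξ * (𝓕 f : L2Space d) ξ) : L2Space d)‖ :=
    (Lp.fourierTransformₗᵢ (EuclideanSpace ℝ (Fin d)) ℂ).symm.norm_map _
  rw [h1, ← Lp.norm_fourier_eq f, Lp.norm_toLp, Lp.norm_def]
  congr 1
  refine eLpNorm_congr_norm_ae ?_
  filter_upwards with ξ
  rw [norm_mul, norm_schrodingerSymbol, one_mul]

/-- Strong continuity of the group: the integral defining `timeAverage` is an honest one. -/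
lemma continuous_schrodingerGroup {d : ℕ} (f : L2Space d) :
    Continuous (fun t : ℝ => schrodingerGroup t f) := by
  unfold schrodingerGroup
  refine (Lp.fourierTransformₗᵢ (EuclideanSpace ℝ (Fin d)) ℂ).symm.continuous.comp ?_
  rw [continuous_iff_continuousAt]
  intro t₀
  set g : L2Space d := 𝓕 f
  refine (Lp.tendsto_Lp_iff_tendsto_eLpNorm'' _
    (fun t => memLp_schrodingerSymbol_mul t g) _ (memLp_schrodingerSymbol_mul t₀ g)).2 ?_
  have key : Filter.Tendsto (fun t : ℝ => ∫⁻ ξ, ‖(schrodingerSymbol t ξ - schrodingerSymbol t₀ ξ)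
      * g ξ‖ₑ ^ (2 : ℝ)) (nhds t₀) (nhds (∫⁻ _ : EuclideanSpace ℝ (Fin d), 0)) := by
    refine tendsto_lintegral_filter_of_dominated_convergence'
      (fun ξ => (2 * ‖g ξ‖ₑ) ^ (2 : ℝ)) ?_ ?_ ?_ ?_
    · filter_upwards with t
      exact ((((continuous_schrodingerSymbol t).sub
        (continuous_schrodingerSymbol t₀)).aestronglyMeasurable.mul
        (Lp.aestronglyMeasurable g)).enorm).pow_const _
    · filter_upwards with t
      filter_upwards with ξ
      rw [enorm_mul]
      gcongr
      refine enorm_sub_le.trans ?_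
      rw [← ofReal_norm, ← ofReal_norm, norm_schrodingerSymbol, norm_schrodingerSymbol]
      norm_num
    · have h := lintegral_rpow_enorm_lt_top_of_eLpNorm_lt_top (by norm_num) (by norm_num)
        (Lp.memLp g).2
      have h2 : ∫⁻ ξ, ‖g ξ‖ₑ ^ (2 : ℝ) < ∞ := by simpa using h
      simp_rw [ENNReal.mul_rpow_of_nonneg _ _ (zero_le_two : (0 : ℝ) ≤ 2)]
      rw [lintegral_const_mul' _ _ (by norm_num)]
      exact ENNReal.mul_ne_top (by norm_num) h2.ne
    · filter_upwards with ξ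
      have hc : Continuous (fun t : ℝ =>
          ‖(schrodingerSymbol t ξ - schrodingerSymbol t₀ ξ) * g ξ‖ₑ ^ (2 : ℝ)) := by
        unfold schrodingerSymbol
        refine (ENNReal.continuous_rpow_const).comp (Continuous.enorm ?_)
        fun_prop
      simpa using hc.tendsto t₀
  have hfun : (fun t : ℝ => eLpNorm ((fun ξ => schrodingerSymbol t ξ * g ξ) -
      fun ξ => schrodingerSymbol t₀ ξ * g ξ) 2 volume) = fun t : ℝ =>
      (∫⁻ ξ, ‖(schrodingerSymbol t ξ - schrodingerSymbol t₀ ξ) * g ξ‖ₑ ^ (2 : ℝ)) ^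
        (1 / 2 : ℝ) := by
    funext t
    rw [eLpNorm_eq_lintegral_rpow_enorm_toReal (by norm_num) (by norm_num)]
    simp [sub_mul]
  rw [hfun]
  have := key.ennrpow_const (1 / 2 : ℝ)
  simpa using this

/-- `T ↦ P^T f` is continuous for `T > 0`, so its mixed norms below are norms of measurable
functions of `T`. -/
lemma continuousOn_timeAverage {d : ℕ} (f : L2Space d) :
    ContinuousOn (fun T : ℝ => timeAverage T f) (Set.Ioi 0) := by
  have hint : ∀ a b : ℝ, IntervalIntegrable (fun t => schrodingerGroup t f) volume a b :=
    fun a b => (continuous_schrodingerGroup f).intervalIntegrable a b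
  have hc : Continuous fun T : ℝ => ∫ t in (0 : ℝ)..T, schrodingerGroup t f :=
    intervalIntegral.continuous_primitive hint 0
  have heq : (fun T : ℝ => timeAverage T f) = fun T : ℝ => (2 * T)⁻¹ •
      ((∫ t in (0 : ℝ)..T, schrodingerGroup t f) -
        ∫ t in (0 : ℝ)..(-T), schrodingerGroup t f) := by
    funext T
    rw [timeAverage, intervalIntegral.integral_interval_sub_left (hint _ _) (hint _ _)]
  rw [heq]
  refine ContinuousOn.smul (ContinuousOn.inv₀
    (continuous_const.mul continuous_id : Continuous fun T : ℝ => 2 * T).continuousOn ?_)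
    (hc.sub (hc.comp continuous_neg)).continuousOn
  intro T hT
  exact mul_ne_zero two_ne_zero (ne_of_gt hT)

/-- Membership of `f ∈ L²(ℝᵈ)` in the weighted space `L^{2,s}(ℝᵈ)`. -/
def MemWeightedL2 {d : ℕ} (s : ℝ) (f : L2Space d) : Prop :=
  Integrable (fun x => ‖f x‖ ^ 2 * (1 + ‖x‖ ^ 2) ^ s) volume

/-- `‖f‖_{L^{2,s}} = (∫ |f(x)|² (1 + |x|²)^s dx)^{1/2}`. -/
def weightedL2Norm {d : ℕ} (s : ℝ) (f : L2Space d) : ℝ :=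
  √(∫ x, ‖f x‖ ^ 2 * (1 + ‖x‖ ^ 2) ^ s)

/-- The mixed norm `‖F‖_{L^q_T L²_x([0,∞) × Ω)}`: the `L^q` norm over `T ∈ [0,∞)` of
`T ↦ ‖F T‖_{L²(Ω)}`. -/
def mixedNorm {d : ℕ} (q : ℝ≥0∞) (Ω : Set (EuclideanSpace ℝ (Fin d)))
    (F : ℝ → L2Space d) : ℝ≥0∞ :=
  eLpNorm (fun T : ℝ => eLpNorm (F T) 2 (volume.restrict Ω)) q (volume.restrict (Set.Ici 0))

end

/-! On the Fourier side `P^T` is multiplication by `sinc (T |2πξ|²)`, so `‖P^T f‖²` is the integral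
of its square against `|𝓕 f|²`. Since `sinc² x ≤ 2 / (1 + x)` for `x ≥ 0`, and `|ξ|` may be lowered
to its component along a fixed unit vector `e`, the choice `b = T^{-1/2}` bounds the multiplier by
`2b` times the Poisson kernel `b / (b² + w²)`, where `w = 2π⟪e, ξ⟫`.

This kernel is the real part of the Laplace transform of `a ↦ exp (i w a)`. By Plancherel its
integral against `|𝓕 f|²` is the real part of `∫₀^∞ e^{-ba} ⟪f(· - a e), f⟫ da`. Bounding `e^{-ba}`
by 1 leaves the `L¹` norm of the autocorrelation of `f` along a line, independent of `b`. A weighted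
AM-GM inequality and Tonelli control it by the weighted norm as soon as `(1 + a²)^{-s}` is
integrable on the line, that is `s > 1/2` in every dimension (`lintegral_lintegral_correlation_le`).

Hence `‖P^T f‖² ≲ b = T^{-1/2}`, which even includes the endpoint `ℓ = 1/2` of (1). With the trivial
contraction bound for small `T`, this decay lies in `L^q` for `q > 4`, giving (2); on a bounded set
the weight is bounded, which gives (3). -/

open scoped InnerProductSpace

/-! ### Translations of `L²` functions and their Fourier transforms. -/

section Translation

variable {V : Type*} [NormedAddCommGroup V] [InnerProductSpace ℝ V] [FiniteDimensional ℝ V]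
  [MeasurableSpace V] [BorelSpace V]

theorem continuous_Lp_top_smul {α : Type*} [MeasurableSpace α] {μ : Measure α}
    (m : Lp ℂ ∞ μ) : Continuous fun f : Lp ℂ 2 μ => (m • f : Lp ℂ 2 μ) := by
  refine (LipschitzWith.of_dist_le_mul (K := ‖m‖₊) fun f g => ?_).continuous
  rw [dist_eq_norm, dist_eq_norm]
  refine le_trans (le_of_eq (congrArg _ ?_)) (Lp.norm_smul_le m (f - g))
  rw [sub_eq_add_neg, sub_eq_add_neg, Lp.add_smul, Lp.smul_neg]

/-- Translation by `v` on `L²(V)`. -/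
noncomputable def translationL2 (v : V) : Lp (α := V) ℂ 2 volume →ₗᵢ[ℂ] Lp (α := V) ℂ 2 volume :=
  Lp.compMeasurePreservingₗᵢ ℂ (fun x => x - v) (measurePreserving_sub_right volume v)

theorem coeFn_translationL2 (v : V) (f : Lp (α := V) ℂ 2 volume) :
    translationL2 v f =ᵐ[volume] fun x => f (x - v) :=
  Lp.coeFn_compMeasurePreserving f (measurePreserving_sub_right volume v)

theorem memLp_top_cexp_inner (v : V) :
    MemLp (fun ξ : V => Complex.exp (((-2 * Real.pi * ⟪v, ξ⟫_ℝ : ℝ) : ℂ) * Complex.I)) ∞ volume :=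
  memLp_top_of_bound (Continuous.aestronglyMeasurable (by fun_prop)) 1
    (Filter.Eventually.of_forall fun ξ => (Complex.norm_exp_ofReal_mul_I _).le)

theorem fourier_comp_sub_const (f : V → ℂ) (v ξ : V) :
    𝓕 (fun x => f (x - v)) ξ =
      Complex.exp (((-2 * Real.pi * ⟪v, ξ⟫_ℝ : ℝ) : ℂ) * Complex.I) * 𝓕 f ξ := by
  have h := congrFun (VectorFourier.fourierIntegral_comp_add_right Real.fourierChar volume
    (innerₗ V) f (-v)) ξ
  simp only [Function.comp_def, ← sub_eq_add_neg] at h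
  refine h.trans ?_
  simp only [map_neg, LinearMap.neg_apply, innerₗ_apply_apply, Circle.smul_def, smul_eq_mul,
    Real.fourierChar_apply]
  congr 2
  push_cast
  ring_nf

/-- Both sides are continuous in `f`, so the pointwise identity for Schwartz functions extends by
density. -/
theorem fourier_translationL2 (v : V) (f : Lp (α := V) ℂ 2 volume) :
    𝓕 (translationL2 v f) =
      ((memLp_top_cexp_inner v).toLp _ • (𝓕 f : Lp (α := V) ℂ 2 volume) :
        Lp (α := V) ℂ 2 volume) := by
  refine DenseRange.induction_on (p := fun f : Lp (α := V) ℂ 2 volume => 𝓕 (translationL2 v f) =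
      ((memLp_top_cexp_inner v).toLp _ • (𝓕 f : Lp (α := V) ℂ 2 volume) :
        Lp (α := V) ℂ 2 volume))
    (SchwartzMap.denseRange_toLpCLM (p := 2) ENNReal.ofNat_ne_top) f ?_ ?_
  · exact isClosed_eq
      ((Lp.fourierTransformₗᵢ V ℂ).continuous.comp (translationL2 v).continuous)
      ((continuous_Lp_top_smul _).comp (Lp.fourierTransformₗᵢ V ℂ).continuous)
  · intro φ
    simp only [SchwartzMap.toLpCLM_apply]
    have h : translationL2 v (φ.toLp 2) = (SchwartzMap.compSubConstCLM ℂ v φ).toLp 2 := by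
      refine Lp.ext ?_
      filter_upwards [coeFn_translationL2 v (φ.toLp 2),
        (measurePreserving_sub_right volume v).quasiMeasurePreserving.ae_eq_comp
          (φ.coeFn_toLp 2 volume),
        (SchwartzMap.compSubConstCLM ℂ v φ).coeFn_toLp 2 volume] with x h1 h2 h3
      rw [h1, h3, SchwartzMap.compSubConstCLM_apply]
      exact h2
    rw [h, SchwartzMap.toLp_fourier_eq, SchwartzMap.toLp_fourier_eq]
    refine Lp.ext ?_
    filter_upwards [(𝓕 (SchwartzMap.compSubConstCLM ℂ v φ)).coeFn_toLp 2 volume,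
      (𝓕 φ).coeFn_toLp 2 volume, (memLp_top_cexp_inner v).coeFn_toLp,
      Lp.coeFn_lpSMul (r := 2) ((memLp_top_cexp_inner v).toLp _) ((𝓕 φ).toLp 2 volume)]
      with ξ h1 h2 h3 h4
    rw [h1, h4, Pi.smul_apply', h2, h3, SchwartzMap.fourier_coe, SchwartzMap.fourier_coe,
      smul_eq_mul]
    exact fourier_comp_sub_const _ v ξ

/-- Plancherel: the autocorrelation is the Fourier transform of the power spectrum. The phase
changes sign because the inner product is conjugate-linear in its first argument. -/
theorem inner_translationL2_self (v : V) (f : Lp (α := V) ℂ 2 volume) :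
    ⟪translationL2 v f, f⟫_ℂ = ∫ ξ, Complex.exp (((2 * Real.pi * ⟪v, ξ⟫_ℝ : ℝ) : ℂ) * Complex.I) *
      ((‖(𝓕 f : Lp (α := V) ℂ 2 volume) ξ‖ ^ 2 : ℝ) : ℂ) := by
  rw [← Lp.inner_fourier_eq, fourier_translationL2, L2.inner_def]
  refine integral_congr_ae ?_
  filter_upwards [(memLp_top_cexp_inner v).coeFn_toLp,
    Lp.coeFn_lpSMul (r := 2) ((memLp_top_cexp_inner v).toLp _)
      (𝓕 f : Lp (α := V) ℂ 2 volume)] with ξ h1 h2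
  rw [h2, Pi.smul_apply', h1, smul_eq_mul, RCLike.inner_apply, map_mul, ← Complex.exp_conj,
    mul_left_comm, Complex.mul_conj, Complex.normSq_eq_norm_sq]
  congr 2
  simp only [map_mul, Complex.conj_ofReal, Complex.conj_I]
  push_cast
  ring

end Translation

/-! ### Autocorrelation along a line and weighted norms. -/

section WeightedCorrelation

/-- AM-GM with crossed weights: each square keeps the weight of its own point, and the decaying
weight of the other point remains to be integrated over the shift. -/
theorem mul_le_weighted_sq_add_sq {A B u v s : ℝ} (hu : 0 < u) (hv : 0 < v) :
    A * B ≤ (A ^ 2 * u ^ s) * v ^ (-s) + (B ^ 2 * v ^ s) * u ^ (-s) := by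
  set c := u ^ s with hc
  set k := v ^ s with hk
  have hc0 : 0 < c := Real.rpow_pos_of_pos hu s
  have hk0 : 0 < k := Real.rpow_pos_of_pos hv s
  rw [Real.rpow_neg hu.le, Real.rpow_neg hv.le, ← hc, ← hk]
  have h : A ^ 2 * c * k⁻¹ + B ^ 2 * k * c⁻¹ = ((A * c) ^ 2 + (B * k) ^ 2) / (c * k) := by
    field_simp
  rw [h, le_div_iff₀ (by positivity)]
  nlinarith [sq_nonneg (A * c - B * k), sq_nonneg (A * c + B * k)]

/-- `∫ (1 + a²)^{-s} da` in `[0, ∞]`. -/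
noncomputable def japaneseMass (s : ℝ) : ℝ≥0∞ :=
  ∫⁻ a : ℝ, ENNReal.ofReal ((1 + a ^ 2) ^ (-s))

theorem japaneseMass_lt_top {s : ℝ} (hs : 1 / 2 < s) : japaneseMass s < ∞ := by
  have h : Integrable (fun x : ℝ => (1 + ‖x‖ ^ 2) ^ (-(2 * s) / 2)) volume :=
    integrable_rpow_neg_one_add_norm_sq (by simp; linarith)
  have h2 : (fun x : ℝ => (1 + ‖x‖ ^ 2) ^ (-(2 * s) / 2)) = fun x => (1 + x ^ 2) ^ (-s) := by
    funext x
    rw [Real.norm_eq_abs, sq_abs]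
    congr 1
    ring
  rw [h2] at h
  exact h.lintegral_lt_top

variable {V : Type*} [NormedAddCommGroup V] [InnerProductSpace ℝ V] [FiniteDimensional ℝ V]
  [MeasurableSpace V] [BorelSpace V]

/-- Correlations along a line of an `L²` function are controlled by its weighted norm. -/
theorem lintegral_lintegral_correlation_le {s : ℝ} (hs : 0 ≤ s) {e : V} (he : ‖e‖ = 1) {f : V → ℂ}
    (hf : Measurable f) :
    ∫⁻ a : ℝ, ∫⁻ x, ‖f (x - a • e)‖ₑ * ‖f x‖ₑ ≤
      2 * japaneseMass s * ∫⁻ x, ENNReal.ofReal (‖f x‖ ^ 2 * (1 + ‖x‖ ^ 2) ^ s) := by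
  -- Only the component along `e` enters the weight: it alone moves with `a`, so the mass to be
  -- integrated is one-dimensional.
  set G : V → ℝ≥0∞ := fun x => ENNReal.ofReal (‖f x‖ ^ 2 * (1 + ⟪e, x⟫_ℝ ^ 2) ^ s) with hG
  set φ : ℝ → ℝ≥0∞ := fun a => ENNReal.ofReal ((1 + a ^ 2) ^ (-s)) with hφ
  have hGm : Measurable G := by fun_prop
  have hφm : Measurable φ := by fun_prop
  have hin : ∀ (x : V) (a : ℝ), ⟪e, x - a • e⟫_ℝ = ⟪e, x⟫_ℝ - a := fun x a => by
    rw [inner_sub_right, inner_smul_right, real_inner_self_eq_norm_sq, he]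
    ring
  have hpt : ∀ (a : ℝ) (x : V), ‖f (x - a • e)‖ₑ * ‖f x‖ₑ ≤
      G (x - a • e) * φ ⟪e, x⟫_ℝ + G x * φ (⟪e, x⟫_ℝ - a) := fun a x => by
    simp only [hG, hφ, hin]
    rw [← ofReal_norm, ← ofReal_norm, ← ENNReal.ofReal_mul (by positivity),
      ← ENNReal.ofReal_mul (by positivity), ← ENNReal.ofReal_mul (by positivity),
      ← ENNReal.ofReal_add (by positivity) (by positivity)]
    exact ENNReal.ofReal_le_ofReal (mul_le_weighted_sq_add_sq (by positivity) (by positivity))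
  have h1 : ∀ a : ℝ, ∫⁻ x, G (x - a • e) * φ ⟪e, x⟫_ℝ = ∫⁻ x, G x * φ (⟪e, x⟫_ℝ + a) :=
    fun a => by
      rw [← lintegral_add_right_eq_self _ (a • e)]
      refine lintegral_congr fun x => ?_
      rw [add_sub_cancel_right, inner_add_right, inner_smul_right, real_inner_self_eq_norm_sq, he]
      ring_nf
  -- Tonelli: with `x` fixed, the integral over `a` of the decaying weight does not depend on `x`.
  have hswap : ∀ ψ : V → ℝ → ℝ≥0∞, Measurable (Function.uncurry ψ) →
      (∀ x, ∫⁻ a, ψ x a = japaneseMass s) →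
      ∫⁻ a : ℝ, ∫⁻ x, G x * ψ x a = (∫⁻ x, G x) * japaneseMass s := fun ψ hψ hx => by
    rw [lintegral_lintegral_swap (by
      exact ((hGm.comp measurable_snd).mul (hψ.comp measurable_swap)).aemeasurable)]
    rw [← lintegral_mul_const _ hGm]
    refine lintegral_congr fun x => ?_
    rw [lintegral_const_mul (f := ψ x) _ (hψ.comp measurable_prodMk_left), hx]
  have hGle : ∫⁻ x, G x ≤ ∫⁻ x, ENNReal.ofReal (‖f x‖ ^ 2 * (1 + ‖x‖ ^ 2) ^ s) := by
    refine lintegral_mono fun x => ENNReal.ofReal_le_ofReal ?_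
    have : ⟪e, x⟫_ℝ ^ 2 ≤ ‖x‖ ^ 2 := by
      rw [← sq_abs]
      have := abs_real_inner_le_norm e x
      rw [he, one_mul] at this
      gcongr
    gcongr
  calc ∫⁻ a : ℝ, ∫⁻ x, ‖f (x - a • e)‖ₑ * ‖f x‖ₑ
      ≤ ∫⁻ a : ℝ, ((∫⁻ x, G x * φ (⟪e, x⟫_ℝ + a)) + ∫⁻ x, G x * φ (⟪e, x⟫_ℝ - a)) := by
        refine lintegral_mono fun a => ?_
        rw [← h1, ← lintegral_add_right _ (by fun_prop)]
        exact lintegral_mono (hpt a)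
    _ = (∫⁻ x, G x) * japaneseMass s + (∫⁻ x, G x) * japaneseMass s := by
        rw [lintegral_add_right, hswap (fun x a => φ (⟪e, x⟫_ℝ + a)),
          hswap (fun x a => φ (⟪e, x⟫_ℝ - a))]
        · fun_prop
        · exact fun x => lintegral_sub_left_eq_self φ _
        · fun_prop
        · exact fun x => lintegral_add_left_eq_self φ _
        · refine Measurable.lintegral_prod_right'
            (f := fun p : ℝ × V => G p.2 * φ (⟪e, p.2⟫_ℝ - p.1)) ?_
          fun_prop
    _ ≤ _ := by
        rw [← two_mul, mul_comm _ (japaneseMass s), ← mul_assoc]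
        gcongr

theorem lintegral_enorm_inner_translationL2_le {s : ℝ} (hs : 0 ≤ s) {e : V} (he : ‖e‖ = 1)
    (f : Lp (α := V) ℂ 2 volume) :
    ∫⁻ a : ℝ, ‖⟪translationL2 (a • e) f, f⟫_ℂ‖ₑ ≤
      2 * japaneseMass s * ∫⁻ x, ENNReal.ofReal (‖f x‖ ^ 2 * (1 + ‖x‖ ^ 2) ^ s) := by
  refine le_trans (lintegral_mono fun a => ?_)
    (lintegral_lintegral_correlation_le hs he (Lp.stronglyMeasurable f).measurable)
  rw [L2.inner_def]
  refine (enorm_integral_le_lintegral_enorm _).trans (lintegral_mono_ae ?_)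
  filter_upwards [coeFn_translationL2 (a • e) f] with x hx
  rw [hx, RCLike.inner_apply, enorm_mul, RCLike.enorm_conj, mul_comm]

end WeightedCorrelation

/-! ### Poisson kernel as a Laplace transform of translations. -/

section Resolvent

theorem integral_Ioi_cexp_re {b : ℝ} (hb : 0 < b) (w : ℝ) :
    (∫ a in Set.Ioi (0 : ℝ), Complex.exp ((-b + w * Complex.I) * a)).re = b / (b ^ 2 + w ^ 2) := by
  rw [integral_exp_mul_complex_Ioi (by simpa using hb)]
  simp [Complex.div_re, Complex.normSq_apply]
  ring

variable {V : Type*} [NormedAddCommGroup V] [InnerProductSpace ℝ V] [FiniteDimensional ℝ V]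
  [MeasurableSpace V] [BorelSpace V]

theorem integrable_norm_sq_L2 {α : Type*} [MeasurableSpace α] {μ : Measure α} (g : Lp ℂ 2 μ) :
    Integrable (fun x => ‖g x‖ ^ 2) μ :=
  (memLp_two_iff_integrable_sq_norm (Lp.aestronglyMeasurable g)).1 (Lp.memLp g)

theorem norm_sq_L2 {α : Type*} [MeasurableSpace α] {μ : Measure α} (g : Lp ℂ 2 μ) :
    ‖g‖ ^ 2 = ∫ x, ‖g x‖ ^ 2 ∂μ := by
  rw [← inner_self_eq_norm_sq (𝕜 := ℂ), L2.inner_def, ← integral_re (L2.integrable_inner g g)]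
  simp only [inner_self_eq_norm_sq]

/-- The resolvent of the generator of translations along `e`, tested on `f`. -/
theorem integral_fourier_sq_resolvent (e : V) {b : ℝ} (hb : 0 < b) (f : Lp (α := V) ℂ 2 volume) :
    ∫ ξ, b / (b ^ 2 + (2 * Real.pi * ⟪e, ξ⟫_ℝ) ^ 2) * ‖(𝓕 f : Lp (α := V) ℂ 2 volume) ξ‖ ^ 2 =
      (∫ a in Set.Ioi (0 : ℝ), (Real.exp (-b * a) : ℂ) * ⟪translationL2 (a • e) f, f⟫_ℂ).re := by
  set g : Lp (α := V) ℂ 2 volume := 𝓕 f with hg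
  set F : ℝ → V → ℂ := fun a ξ =>
    Complex.exp (((2 * Real.pi * ⟪a • e, ξ⟫_ℝ : ℝ) : ℂ) * Complex.I) *
      ((Real.exp (-b * a) : ℂ) * ((‖g ξ‖ ^ 2 : ℝ) : ℂ)) with hF
  have hexp : Integrable (fun a : ℝ => (Real.exp (-b * a) : ℂ)) (volume.restrict (Set.Ioi 0)) :=
    (exp_neg_integrableOn_Ioi 0 hb).ofReal
  -- The phase has modulus one, so Fubini reduces to `e^{-ba}` on the half-line times the integrable
  -- `|𝓕 f|²`.
  have hFint : Integrable (Function.uncurry F) ((volume.restrict (Set.Ioi 0)).prod volume) := by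
    refine Integrable.bdd_mul (c := 1) (hexp.mul_prod (integrable_norm_sq_L2 g).ofReal)
      (Continuous.aestronglyMeasurable (by fun_prop))
      (Filter.Eventually.of_forall fun p => (Complex.norm_exp_ofReal_mul_I _).le)
  have h1 : ∀ a : ℝ, (Real.exp (-b * a) : ℂ) * ⟪translationL2 (a • e) f, f⟫_ℂ = ∫ ξ, F a ξ := by
    intro a
    rw [inner_translationL2_self, ← integral_const_mul]
    refine integral_congr_ae (Filter.Eventually.of_forall fun ξ => ?_)
    simp only [hF]
    ring
  have h2 : ∀ ξ, ∫ a in Set.Ioi (0 : ℝ), F a ξ =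
      (∫ a in Set.Ioi (0 : ℝ),
        Complex.exp ((-b + (2 * Real.pi * ⟪e, ξ⟫_ℝ : ℝ) * Complex.I) * a)) *
        ((‖g ξ‖ ^ 2 : ℝ) : ℂ) := by
    intro ξ
    rw [← integral_mul_const]
    refine integral_congr_ae (Filter.Eventually.of_forall fun a => ?_)
    simp only [hF, real_inner_smul_left]
    rw [← mul_assoc, Complex.ofReal_exp, ← Complex.exp_add]
    congr 2
    push_cast
    ring
  simp_rw [h1]
  rw [integral_integral_swap hFint]
  have h3 := integral_re hFint.integral_prod_right
  simp only [Function.uncurry_apply_pair, RCLike.re_to_complex] at h3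
  rw [← h3]
  refine integral_congr_ae (Filter.Eventually.of_forall fun ξ => ?_)
  simp only
  rw [h2, Complex.re_mul_ofReal, integral_Ioi_cexp_re hb]

/-- As `e^{-ba} ≤ 1` on the half-line, the bound is uniform in `b`; the factor `b` gained later is
therefore pure decay. -/
theorem integral_fourier_sq_resolvent_le {e : V} {b : ℝ} (hb : 0 < b)
    (f : Lp (α := V) ℂ 2 volume) {K : ℝ} (hK : 0 ≤ K)
    (h : ∫⁻ a : ℝ, ‖⟪translationL2 (a • e) f, f⟫_ℂ‖ₑ ≤ ENNReal.ofReal K) :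
    ∫ ξ, b / (b ^ 2 + (2 * Real.pi * ⟪e, ξ⟫_ℝ) ^ 2) *
      ‖(𝓕 f : Lp (α := V) ℂ 2 volume) ξ‖ ^ 2 ≤ K := by
  rw [integral_fourier_sq_resolvent e hb f]
  refine (Complex.re_le_norm _).trans ?_
  rw [← ENNReal.ofReal_le_ofReal_iff hK, ofReal_norm]
  refine le_trans ?_ h
  refine (enorm_integral_le_lintegral_enorm _).trans ?_
  refine le_trans (setLIntegral_mono' measurableSet_Ioi fun a ha => ?_)
    (setLIntegral_le_lintegral (Set.Ioi 0) _)
  rw [enorm_mul]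
  refine mul_le_of_le_one_left' ?_
  rw [← ofReal_norm, Complex.norm_real, Real.norm_eq_abs, Real.abs_exp]
  refine ENNReal.ofReal_le_one.2 (Real.exp_le_one_iff.2 ?_)
  have : (0 : ℝ) < a := ha
  nlinarith [mul_pos hb this]

end Resolvent

/-! ### The ergodic average as a Fourier multiplier. -/

section TimeAverage

/-- Sum of `sinc² x ≤ 1` and `x sinc² x ≤ 1`. -/
theorem sinc_sq_le {x : ℝ} (hx : 0 ≤ x) : Real.sinc x ^ 2 ≤ 2 / (1 + x) := by
  rw [le_div_iff₀ (by linarith)]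
  have h1 : Real.sinc x ^ 2 ≤ 1 := by
    rw [← sq_abs]
    exact pow_le_one₀ (abs_nonneg _) (Real.abs_sinc_le_one x)
  have h2 : Real.sinc x ^ 2 * x ≤ 1 := by
    rcases hx.eq_or_lt with rfl | hx
    · simp
    rcases le_total x 1 with h | h
    · nlinarith [sq_nonneg (Real.sinc x)]
    rw [Real.sinc_of_ne_zero hx.ne', div_pow, div_mul_eq_mul_div, div_le_one (by positivity)]
    nlinarith [Real.sin_sq_le_one x]
  linarith

variable {d : ℕ}

theorem fourier_schrodingerGroup (t : ℝ) (f : L2Space d) :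
    𝓕 (schrodingerGroup t f) = ((memLp_schrodingerSymbol_mul t (𝓕 f)).toLp
      (fun ξ => schrodingerSymbol t ξ * (𝓕 f : L2Space d) ξ) : L2Space d) :=
  (Lp.fourierTransformₗᵢ (EuclideanSpace ℝ (Fin d)) ℂ).apply_symm_apply _

theorem average_schrodingerSymbol {T : ℝ} (hT : 0 < T) (ξ : EuclideanSpace ℝ (Fin d)) :
    ((2 * T)⁻¹ : ℂ) * ∫ t in (-T)..T, schrodingerSymbol t ξ =
      Real.sinc (T * (2 * Real.pi * ‖ξ‖) ^ 2) := by
  set w := (2 * Real.pi * ‖ξ‖) ^ 2 with hw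
  have hT' : (T : ℂ) ≠ 0 := by exact_mod_cast hT.ne'
  have h0 : ∀ t : ℝ, schrodingerSymbol t ξ = Complex.exp (((w * t : ℝ) : ℂ) * Complex.I) := by
    intro t
    rw [schrodingerSymbol, mul_comm, mul_comm t]
  simp_rw [h0]
  -- The rescaling `t ↦ w t` degenerates at zero frequency.
  by_cases hw0 : w = 0
  · simp [hw0]
    field_simp
    ring
  · rw [intervalIntegral.integral_comp_mul_left (fun y : ℝ => Complex.exp ((y : ℂ) * Complex.I)) hw0]
    rw [mul_neg, integral_exp_mul_I_eq_sinc, mul_comm T w]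
    have : (w : ℂ) ≠ 0 := by exact_mod_cast hw0
    rw [Complex.real_smul]
    push_cast
    field_simp

theorem memLp_sinc_mul (T : ℝ) (g : L2Space d) :
    MemLp (fun ξ => (Real.sinc (T * (2 * Real.pi * ‖ξ‖) ^ 2) : ℂ) * g ξ) 2 volume := by
  refine (Lp.memLp g).of_le (AEStronglyMeasurable.mul (Continuous.aestronglyMeasurable ?_)
    (Lp.aestronglyMeasurable g)) ?_
  · exact Complex.continuous_ofReal.comp (Real.continuous_sinc.comp (by fun_prop))
  filter_upwards with ξ
  rw [norm_mul, Complex.norm_real, Real.norm_eq_abs]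
  exact mul_le_of_le_one_left (norm_nonneg _) (Real.abs_sinc_le_one _)

/-- The ergodic average is the Fourier multiplier with symbol `sinc (T |2πξ|²)`. -/
theorem fourier_timeAverage {T : ℝ} (hT : 0 < T) (f : L2Space d) :
    𝓕 (timeAverage T f) = (memLp_sinc_mul T (𝓕 f)).toLp _ := by
  set g : L2Space d := 𝓕 f with hg
  -- Testing against `h` turns the `L²`-valued time integral into scalar integrals, to which Fubini
  -- applies.
  refine ext_inner_left ℂ fun h => ?_
  have hcont : Continuous fun t : ℝ => (𝓕 (schrodingerGroup t f) : L2Space d) :=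
    (Lp.fourierTransformₗᵢ (EuclideanSpace ℝ (Fin d)) ℂ).continuous.comp
      (continuous_schrodingerGroup f)
  have h1 : (𝓕 (timeAverage T f) : L2Space d) =
      ((2 * T)⁻¹ : ℂ) • ∫ t in (-T)..T, (𝓕 (schrodingerGroup t f) : L2Space d) := by
    have := ((Lp.fourierTransformₗᵢ (EuclideanSpace ℝ (Fin d)) ℂ).toLinearIsometry.toContinuousLinearMap).intervalIntegral_comp_comm
      ((continuous_schrodingerGroup f).intervalIntegrable (μ := volume) (-T) T)
    refine Eq.trans ?_ (congrArg (((2 * T)⁻¹ : ℂ) • ·) this.symm)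
    have h2 : timeAverage T f = ((2 * T)⁻¹ : ℂ) • ∫ t in (-T)..T, schrodingerGroup t f := by
      refine Lp.ext ?_
      filter_upwards [Lp.coeFn_smul (2 * T)⁻¹ (∫ t in (-T)..T, schrodingerGroup t f),
        Lp.coeFn_smul ((2 * T)⁻¹ : ℂ) (∫ t in (-T)..T, schrodingerGroup t f)] with x hx hx'
      rw [timeAverage, hx, hx', Pi.smul_apply, Pi.smul_apply, Complex.real_smul, smul_eq_mul]
      push_cast
      rfl
    rw [h2]
    exact (Lp.fourierTransformₗᵢ (EuclideanSpace ℝ (Fin d)) ℂ).map_smul _ _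
  have hF : Integrable (Function.uncurry fun (t : ℝ) (ξ : EuclideanSpace ℝ (Fin d)) =>
      schrodingerSymbol t ξ * ⟪h ξ, g ξ⟫_ℂ) ((volume.restrict (Set.Ioc (-T) T)).prod volume) := by
    refine Integrable.bdd_mul (c := 1) ((L2.integrable_inner (𝕜 := ℂ) h g).comp_snd _)
      (Continuous.aestronglyMeasurable ?_)
      (Filter.Eventually.of_forall fun p => (norm_schrodingerSymbol _ _).le)
    unfold schrodingerSymbol
    fun_prop
  have h3 : ∀ t : ℝ, ⟪h, (𝓕 (schrodingerGroup t f) : L2Space d)⟫_ℂ =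
      ∫ ξ, schrodingerSymbol t ξ * ⟪h ξ, g ξ⟫_ℂ := fun t => by
    rw [fourier_schrodingerGroup, L2.inner_def]
    refine integral_congr_ae ?_
    filter_upwards [(memLp_schrodingerSymbol_mul t g).coeFn_toLp] with ξ hξ
    rw [hξ, ← smul_eq_mul, inner_smul_right]
  rw [h1, inner_smul_right, ← innerSL_apply_apply (𝕜 := ℂ) h,
    ← (innerSL ℂ h).intervalIntegral_comp_comm (hcont.intervalIntegrable _ _)]
  simp only [innerSL_apply_apply, h3]
  rw [intervalIntegral.integral_of_le (by linarith), integral_integral_swap hF,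
    ← integral_const_mul, L2.inner_def]
  refine integral_congr_ae ?_
  filter_upwards [(memLp_sinc_mul T g).coeFn_toLp] with ξ hξ
  rw [hξ, integral_mul_const, ← mul_assoc, ← intervalIntegral.integral_of_le (by linarith),
    average_schrodingerSymbol hT, ← smul_eq_mul (a := (Real.sinc _ : ℂ)),
    ← smul_eq_mul (a := (Real.sinc _ : ℂ)), inner_smul_right, smul_eq_mul]

theorem norm_timeAverage_sq {T : ℝ} (hT : 0 < T) (f : L2Space d) :
    ‖timeAverage T f‖ ^ 2 = ∫ ξ, Real.sinc (T * (2 * Real.pi * ‖ξ‖) ^ 2) ^ 2 *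
      ‖(𝓕 f : L2Space d) ξ‖ ^ 2 := by
  rw [← Lp.norm_fourier_eq, fourier_timeAverage hT, norm_sq_L2]
  refine integral_congr_ae ?_
  filter_upwards [(memLp_sinc_mul T (𝓕 f)).coeFn_toLp] with ξ hξ
  rw [hξ, norm_mul, Complex.norm_real, Real.norm_eq_abs, mul_pow, sq_abs]

end TimeAverage

/-! ### Decay in `T` and mixed norms. -/

section Decay

variable {d : ℕ}

theorem integral_weight_nonneg (s : ℝ) (f : L2Space d) :
    0 ≤ ∫ x, ‖f x‖ ^ 2 * (1 + ‖x‖ ^ 2) ^ s :=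
  integral_nonneg fun x => by positivity

theorem lintegral_weight_eq {s : ℝ} {f : L2Space d} (hf : MemWeightedL2 s f) :
    ∫⁻ x, ENNReal.ofReal (‖f x‖ ^ 2 * (1 + ‖x‖ ^ 2) ^ s) =
      ENNReal.ofReal (∫ x, ‖f x‖ ^ 2 * (1 + ‖x‖ ^ 2) ^ s) := by
  unfold MemWeightedL2 at hf
  exact (ofReal_integral_eq_lintegral_ofReal hf
    (Filter.Eventually.of_forall fun x => by positivity)).symm

theorem norm_le_weightedL2Norm {s : ℝ} (hs : 0 ≤ s) {f : L2Space d} (hf : MemWeightedL2 s f) :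
    ‖f‖ ≤ weightedL2Norm s f := by
  refine Real.le_sqrt_of_sq_le ?_
  rw [norm_sq_L2]
  refine integral_mono (integrable_norm_sq_L2 f) hf fun x => ?_
  exact le_mul_of_one_le_right (by positivity)
    (Real.one_le_rpow (le_add_of_nonneg_right (by positivity)) hs)

theorem norm_timeAverage_le {T : ℝ} (hT : 0 ≤ T) (f : L2Space d) : ‖timeAverage T f‖ ≤ ‖f‖ := by
  rcases hT.eq_or_lt with rfl | hT
  -- At `T = 0` the average is `0`, since `0⁻¹ = 0`.
  · simp [timeAverage]
  refine le_of_sq_le_sq ?_ (norm_nonneg f)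
  rw [norm_timeAverage_sq hT, ← Lp.norm_fourier_eq f, norm_sq_L2]
  refine integral_mono_of_nonneg (Filter.Eventually.of_forall fun ξ => by positivity)
    (integrable_norm_sq_L2 _) (Filter.Eventually.of_forall fun ξ => ?_)
  refine mul_le_of_le_one_left (by positivity) ?_
  rw [← sq_abs]
  exact pow_le_one₀ (abs_nonneg _) (Real.abs_sinc_le_one _)

/-- With `T b² = 1`, `2 / (1 + T w²) = 2b · b / (b² + w²)`; replacing `|ξ|` by `⟪e, ξ⟫` only
enlarges this. -/
theorem norm_timeAverage_sq_le_resolvent {T b : ℝ} (hb : 0 < b) (hTb : T * b ^ 2 = 1)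
    {e : EuclideanSpace ℝ (Fin d)} (he : ‖e‖ = 1) (f : L2Space d) :
    ‖timeAverage T f‖ ^ 2 ≤ 2 * b * ∫ ξ, b / (b ^ 2 + (2 * Real.pi * ⟪e, ξ⟫_ℝ) ^ 2) *
      ‖(𝓕 f : L2Space d) ξ‖ ^ 2 := by
  have hT : 0 < T := pos_of_mul_pos_left (hTb ▸ one_pos) (sq_nonneg b)
  rw [norm_timeAverage_sq hT, ← integral_const_mul]
  refine integral_mono_of_nonneg (Filter.Eventually.of_forall fun ξ => by positivity) ?_
    (Filter.Eventually.of_forall fun ξ => ?_)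
  · refine Integrable.const_mul (Integrable.bdd_mul (c := b⁻¹) (integrable_norm_sq_L2 _)
      (Continuous.aestronglyMeasurable ?_) (Filter.Eventually.of_forall fun ξ => ?_)) _
    · refine continuous_const.div (by fun_prop) fun ξ => ?_
      positivity
    · rw [Real.norm_of_nonneg (by positivity), div_le_iff₀ (by positivity), mul_add,
        inv_mul_eq_div, sq b, mul_self_div_self]
      exact le_add_of_nonneg_right (by positivity)
  · simp only
    rw [← mul_assoc]
    refine mul_le_mul_of_nonneg_right ?_ (by positivity)
    refine (sinc_sq_le (by positivity)).trans ?_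
    have h1 : (2 * Real.pi * ⟪e, ξ⟫_ℝ) ^ 2 ≤ (2 * Real.pi * ‖ξ‖) ^ 2 := by
      rw [mul_pow, mul_pow _ ‖ξ‖, ← sq_abs ⟪e, ξ⟫_ℝ]
      have := abs_real_inner_le_norm e ξ
      rw [he, one_mul] at this
      gcongr
    have h2 : 2 * b * (b / (b ^ 2 + (2 * Real.pi * ⟪e, ξ⟫_ℝ) ^ 2)) =
        2 / (1 + T * (2 * Real.pi * ⟪e, ξ⟫_ℝ) ^ 2) := by
      rw [← mul_div_assoc, div_eq_div_iff (by positivity) (by positivity)]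
      linear_combination 2 * (2 * Real.pi * ⟪e, ξ⟫_ℝ) ^ 2 * hTb
    rw [h2]
    gcongr

theorem lintegral_enorm_inner_translationL2_le_ofReal {s : ℝ} (hs : 1 / 2 < s)
    {e : EuclideanSpace ℝ (Fin d)} (he : ‖e‖ = 1) {f : L2Space d} (hf : MemWeightedL2 s f) :
    ∫⁻ a : ℝ, ‖⟪translationL2 (a • e) f, f⟫_ℂ‖ₑ ≤
      ENNReal.ofReal (2 * (japaneseMass s).toReal * ∫ x, ‖f x‖ ^ 2 * (1 + ‖x‖ ^ 2) ^ s) := by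
  have hs0 : 0 ≤ s := by linarith
  refine (lintegral_enorm_inner_translationL2_le hs0 he f).trans_eq ?_
  rw [lintegral_weight_eq hf, ENNReal.ofReal_mul (mul_nonneg zero_le_two ENNReal.toReal_nonneg),
    ENNReal.ofReal_mul zero_le_two, ENNReal.ofReal_toReal (japaneseMass_lt_top hs).ne,
    ENNReal.ofReal_ofNat]

/-- Decay of the ergodic averages at the rate `T^{-1/4}`. -/
theorem norm_timeAverage_le_weighted (hd : 1 ≤ d) {s : ℝ} (hs : 1 / 2 < s) {f : L2Space d}
    (hf : MemWeightedL2 s f) {T : ℝ} (hT : 0 < T) :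
    ‖timeAverage T f‖ ≤
      2 * √(japaneseMass s).toReal * T ^ (-(1 / 4) : ℝ) * weightedL2Norm s f := by
  set Φ := (japaneseMass s).toReal with hΦ
  set I := ∫ x, ‖f x‖ ^ 2 * (1 + ‖x‖ ^ 2) ^ s with hI
  have hI0 : 0 ≤ I := integral_weight_nonneg s f
  have hΦ0 : 0 ≤ Φ := ENNReal.toReal_nonneg
  -- Any unit vector would do; `d ≥ 1` provides one.
  set e : EuclideanSpace ℝ (Fin d) := EuclideanSpace.single ⟨0, hd⟩ 1 with he'
  have he : ‖e‖ = 1 := by simp [he']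
  set b := T ^ (-(1 / 2) : ℝ) with hb'
  have hb : 0 < b := Real.rpow_pos_of_pos hT _
  have hTb : T * b ^ 2 = 1 := by
    rw [hb', ← Real.rpow_natCast, ← Real.rpow_mul hT.le]
    norm_num
    rw [Real.rpow_neg_one, mul_inv_cancel₀ hT.ne']
  have hcb : (T ^ (-(1 / 4) : ℝ)) ^ 2 = b := by
    rw [hb', ← Real.rpow_natCast, ← Real.rpow_mul hT.le]
    norm_num
  have hK := lintegral_enorm_inner_translationL2_le_ofReal hs he hf
  refine le_of_sq_le_sq ?_ (mul_nonneg (mul_nonneg (mul_nonneg zero_le_two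
    (Real.sqrt_nonneg _)) (Real.rpow_nonneg hT.le _)) (Real.sqrt_nonneg _))
  calc ‖timeAverage T f‖ ^ 2 ≤ _ := norm_timeAverage_sq_le_resolvent hb hTb he f
    _ ≤ 2 * b * (2 * Φ * I) := by
        gcongr
        exact integral_fourier_sq_resolvent_le hb f (mul_nonneg (mul_nonneg zero_le_two hΦ0) hI0) hK
    _ = _ := by
        rw [mul_pow, mul_pow, mul_pow, Real.sq_sqrt hΦ0, hcb, weightedL2Norm, Real.sq_sqrt hI0]
        ring

/-- Contraction covers `T ≤ 1` and decay covers `T > 1`. Passing to `1 + T` costs a factor at most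
2, whence the constants 2 and 4. -/
theorem norm_timeAverage_le_one_add (hd : 1 ≤ d) {s : ℝ} (hs : 1 / 2 < s) {f : L2Space d}
    (hf : MemWeightedL2 s f) {T : ℝ} (hT : 0 ≤ T) :
    ‖timeAverage T f‖ ≤ (2 + 4 * √(japaneseMass s).toReal) * weightedL2Norm s f *
      (1 + ‖T‖) ^ (-(1 / 4) : ℝ) := by
  have hW : 0 ≤ weightedL2Norm s f := Real.sqrt_nonneg _
  have hΦ : 0 ≤ √(japaneseMass s).toReal := Real.sqrt_nonneg _
  set W := weightedL2Norm s f
  set Φ := √(japaneseMass s).toReal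
  rw [Real.norm_of_nonneg hT]
  have hq : 0 ≤ (1 + T) ^ (-(1 / 4) : ℝ) := by positivity
  have h2 : (2⁻¹ : ℝ) ≤ 2 ^ (-(1 / 4) : ℝ) := by
    rw [← Real.rpow_neg_one]
    exact Real.rpow_le_rpow_of_exponent_le (by norm_num) (by norm_num)
  rcases le_or_gt T 1 with h | h
  · have h1 : (2 : ℝ) ^ (-(1 / 4) : ℝ) ≤ (1 + T) ^ (-(1 / 4) : ℝ) :=
      Real.rpow_le_rpow_of_nonpos (by linarith) (by linarith) (by norm_num)
    calc ‖timeAverage T f‖ ≤ W :=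
          (norm_timeAverage_le hT f).trans (norm_le_weightedL2Norm (by linarith) hf)
      _ = 2 * W * 2⁻¹ := by ring
      _ ≤ (2 + 4 * Φ) * W * (1 + T) ^ (-(1 / 4) : ℝ) := by
          gcongr
          · linarith
          · linarith
  · have h1 : T ^ (-(1 / 4) : ℝ) * 2⁻¹ ≤ (1 + T) ^ (-(1 / 4) : ℝ) := by
      calc T ^ (-(1 / 4) : ℝ) * 2⁻¹ ≤ T ^ (-(1 / 4) : ℝ) * 2 ^ (-(1 / 4) : ℝ) := by gcongr
        _ = (T * 2) ^ (-(1 / 4) : ℝ) := (Real.mul_rpow hT (by norm_num)).symm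
        _ ≤ _ := Real.rpow_le_rpow_of_nonpos (by linarith) (by linarith) (by norm_num)
    calc ‖timeAverage T f‖ ≤ 2 * Φ * T ^ (-(1 / 4) : ℝ) * W :=
          norm_timeAverage_le_weighted hd hs hf (by linarith)
      _ = 4 * Φ * W * (T ^ (-(1 / 4) : ℝ) * 2⁻¹) := by ring
      _ ≤ (2 + 4 * Φ) * W * (1 + T) ^ (-(1 / 4) : ℝ) := by
          gcongr
          linarith

/-- The threshold `q > 4` arises here: `(1 + |T|)^{-q/4}` is integrable on the line when `q / 4 >
1`. -/
theorem memLp_one_add_norm_rpow {q : ℝ≥0∞} (hq : 4 < q) :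
    MemLp (fun T : ℝ => (1 + ‖T‖) ^ (-(1 / 4) : ℝ)) q volume := by
  have hm : AEStronglyMeasurable (fun T : ℝ => (1 + ‖T‖) ^ (-(1 / 4) : ℝ)) volume := by
    exact Measurable.aestronglyMeasurable (by fun_prop)
  by_cases hq' : q = ∞
  · subst hq'
    refine memLp_top_of_bound hm 1 (Filter.Eventually.of_forall fun T => ?_)
    rw [Real.norm_of_nonneg (by positivity)]
    exact Real.rpow_le_one_of_one_le_of_nonpos (le_add_of_nonneg_right (norm_nonneg T))
      (by norm_num)
  · have h4 : 4 < q.toReal := by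
      simpa using (ENNReal.toReal_lt_toReal (by norm_num) hq').2 hq
    rw [← integrable_norm_rpow_iff hm (pos_of_gt hq).ne' hq']
    have h := integrable_one_add_norm (E := ℝ) (μ := volume) (r := q.toReal / 4)
      (by simp; linarith)
    refine h.congr (Filter.Eventually.of_forall fun T => ?_)
    simp only
    rw [Real.norm_of_nonneg (show 0 ≤ (1 + ‖T‖) ^ (-(1 / 4) : ℝ) by positivity),
      ← Real.rpow_mul (by positivity)]
    congr 1
    ring

theorem mixedNorm_mono {q : ℝ≥0∞} (Ω : Set (EuclideanSpace ℝ (Fin d))) (F : ℝ → L2Space d) :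
    mixedNorm q Ω F ≤ mixedNorm q Set.univ F := by
  refine eLpNorm_mono_enorm fun T => ?_
  simp only [enorm_eq_self, Measure.restrict_univ]
  exact eLpNorm_mono_measure _ Measure.restrict_le_self

theorem exists_mixedNorm_timeAverage_le (hd : 1 ≤ d) {s : ℝ} (hs : 1 / 2 < s) {q : ℝ≥0∞}
    (hq : 4 < q) : ∃ C : ℝ≥0, ∀ f : L2Space d, MemWeightedL2 s f →
      mixedNorm q Set.univ (fun T => timeAverage T f) ≤
        C * ENNReal.ofReal (weightedL2Norm s f) := by
  set A : ℝ := 2 + 4 * √(japaneseMass s).toReal with hA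
  have hA0 : 0 ≤ A := by positivity
  set N := eLpNorm (fun T : ℝ => (1 + ‖T‖) ^ (-(1 / 4) : ℝ)) q (volume.restrict (Set.Ici 0))
  have hN : N ≠ ∞ := ((memLp_one_add_norm_rpow hq).restrict _).2.ne
  refine ⟨A.toNNReal * N.toNNReal, fun f hf => ?_⟩
  have hW : 0 ≤ weightedL2Norm s f := Real.sqrt_nonneg _
  have key : mixedNorm q Set.univ (fun T => timeAverage T f) ≤
      (A * weightedL2Norm s f).toNNReal * N := by
    refine eLpNorm_le_mul_eLpNorm_of_ae_le_mul'' _ ?_ ?_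
    · exact Measurable.aestronglyMeasurable (by fun_prop)
    filter_upwards [ae_restrict_mem measurableSet_Ici] with T hT
    have h := norm_timeAverage_le_one_add hd hs hf (show (0 : ℝ) ≤ T from hT)
    rw [enorm_eq_self, Measure.restrict_univ, ← Lp.enorm_def, ← ofReal_norm,
      ← ofReal_norm ((1 + ‖T‖) ^ (-(1 / 4) : ℝ)), Real.norm_of_nonneg (by positivity)]
    change _ ≤ ENNReal.ofReal _ * _
    rw [← ENNReal.ofReal_mul (by positivity)]
    exact ENNReal.ofReal_le_ofReal h
  refine key.trans_eq ?_
  change ENNReal.ofReal _ * N = _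
  rw [ENNReal.ofReal_mul hA0, ENNReal.coe_mul, ENNReal.coe_toNNReal hN]
  change _ = ENNReal.ofReal A * N * _
  ring

theorem memWeightedL2_of_bounded_support {Ω : Set (EuclideanSpace ℝ (Fin d))} {R : ℝ}
    (hR : ∀ x ∈ Ω, ‖x‖ ≤ R) {f : L2Space d} (hf : ∀ᵐ x, x ∉ Ω → f x = 0) :
    MemWeightedL2 1 f ∧ weightedL2Norm 1 f ≤ √(1 + R ^ 2) * ‖f‖ := by
  have hle : ∀ᵐ x, ‖f x‖ ^ 2 * (1 + ‖x‖ ^ 2) ^ (1 : ℝ) ≤ (1 + R ^ 2) * ‖f x‖ ^ 2 := by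
    filter_upwards [hf] with x hx
    by_cases hxΩ : x ∈ Ω
    · rw [Real.rpow_one, mul_comm]
      have := hR x hxΩ
      gcongr
    · simp [hx hxΩ]
  have hint := (integrable_norm_sq_L2 f).const_mul (1 + R ^ 2)
  have hmem : MemWeightedL2 1 f := by
    refine hint.mono' (((Lp.aestronglyMeasurable f).norm.pow 2).mul
      (Measurable.aestronglyMeasurable (by fun_prop))) ?_
    filter_upwards [hle] with x hx
    rwa [Real.norm_of_nonneg (by positivity)]
  refine ⟨hmem, ?_⟩
  rw [weightedL2Norm, ← Real.sqrt_sq (norm_nonneg f), ← Real.sqrt_mul (by positivity), norm_sq_L2,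
    ← integral_const_mul]
  exact Real.sqrt_le_sqrt (integral_mono_ae hmem hint hle)

theorem eLpNorm_restrict_of_ae_eq_zero {Ω : Set (EuclideanSpace ℝ (Fin d))}
    (hΩ : MeasurableSet Ω) {f : L2Space d} (hf : ∀ᵐ x, x ∉ Ω → f x = 0) :
    eLpNorm f 2 (volume.restrict Ω) = ENNReal.ofReal ‖f‖ := by
  rw [ofReal_norm, Lp.enorm_def, ← eLpNorm_indicator_eq_eLpNorm_restrict hΩ]
  refine eLpNorm_congr_ae ?_
  filter_upwards [hf] with x hx
  by_cases hxΩ : x ∈ Ω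
  · rw [Set.indicator_of_mem hxΩ]
  · rw [Set.indicator_of_notMem hxΩ, hx hxΩ]

end Decay

theorem mainTheorem4 (d : ℕ) (hd : 1 ≤ d) :
    (∀ s : ℝ, 1 / 2 < s →
      (∀ ℓ : ℝ, ℓ < 1 / 2 → ∃ C : ℝ, ∀ f₀ : L2Space d, MemWeightedL2 s f₀ →
        ∀ T : ℝ, 1 < T → ‖timeAverage T f₀‖ ≤ C * T ^ (-ℓ / 2) * weightedL2Norm s f₀) ∧
      (∀ q : ℝ≥0∞, 4 < q → ∃ C : ℝ≥0, ∀ f₀ : L2Space d, MemWeightedL2 s f₀ →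
        mixedNorm q Set.univ (fun T => timeAverage T f₀) ≤
          C * ENNReal.ofReal (weightedL2Norm s f₀))) ∧
    (∀ Ω : Set (EuclideanSpace ℝ (Fin d)), IsOpen Ω → Bornology.IsBounded Ω →
      ∀ q : ℝ≥0∞, 4 < q → ∃ C : ℝ≥0, ∀ f₀ : L2Space d,
        (∀ᵐ x, x ∉ Ω → f₀ x = 0) →
          mixedNorm q Ω (fun T => timeAverage T f₀) ≤
            C * eLpNorm f₀ 2 (volume.restrict Ω)) := by
  refine ⟨fun s hs => ⟨fun ℓ hℓ => ?_, fun q hq => exists_mixedNorm_timeAverage_le hd hs hq⟩,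
    fun Ω hΩ hb q hq => ?_⟩
  -- The constant does not depend on `ℓ`: for `T > 1`, `T^{-1/4} ≤ T^{-ℓ/2}`.
  · refine ⟨2 * √(japaneseMass s).toReal, fun f hf T hT => ?_⟩
    have hW : 0 ≤ weightedL2Norm s f := Real.sqrt_nonneg _
    refine (norm_timeAverage_le_weighted hd hs hf (by linarith)).trans ?_
    gcongr
    · exact hT.le
    · linarith
  -- Any `s > 1/2` would serve; `s = 1` makes the weight `1 + |x|²`, at most `1 + R²` on `Ω`.
  · obtain ⟨C, hC⟩ := exists_mixedNorm_timeAverage_le hd (s := 1) (by norm_num) hq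
    obtain ⟨R, hR⟩ := hb.exists_norm_le
    refine ⟨C * (√(1 + R ^ 2)).toNNReal, fun f hf => ?_⟩
    obtain ⟨hmem, hle⟩ := memWeightedL2_of_bounded_support hR hf
    refine (mixedNorm_mono Ω _).trans ((hC f hmem).trans ?_)
    rw [eLpNorm_restrict_of_ae_eq_zero hΩ.measurableSet hf, ENNReal.coe_mul, mul_assoc]
    gcongr
    change _ ≤ ENNReal.ofReal _ * _
    rw [← ENNReal.ofReal_mul (by positivity)]
    exact ENNReal.ofReal_le_ofReal hle
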